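/- **Setting.** There are $m$ disjoint communities; community $C_i$ has $d_i\ge 1$ members, and $\mu_i=1/d_i$. A budget $K>m$ is given; put $K'=K-m+1$. A realization $\phi$ maps each pair $(i,\tau)\in[m]\times[K]$ to a member $\phi(i,\tau)\in C_i$, the member met in the $\tau$-th exploration of $C_i$. In a random realization $\Phi$ all the $\Phi(i,\tau)$ are independent, and $\Phi(i,\tau)$ is uniform on $C_i$. For $\boldsymbol k\in\mathbb{N}^m$ with $\sum_i k_i\le K$ the reward $R(\boldsymbol k,\phi)=\sum_i|\{\phi(i,1),\dots,\phi(i,k_i)\}|$ is the number of distinct members met, $r_{\boldsymbol k}=\mathbb{E}_\Phi[R(\boldsymbol k,\Phi)]$, and $\boldsymbol k^*$ is a maximizer of $r_{\boldsymbol k}$ over all $\boldsymbol k$ with $\sum_i k_i\le K$. For $\boldsymbol k$ with $\sum_i k_i=K$ let $\Delta_{\boldsymbol k}=r_{\boldsymbol k^*}-r_{\boldsymbol k}$. For each $i$ let $\Delta^i_{\min}$ and $\Delta^i_{\max}$ be the minimum and the maximum of $\Delta_{\boldsymbol k}$ over all $\boldsymbol k$ with $\sum_j k_j=K$, $\Delta_{\boldsymbol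 k}>0$ and $k_i>1$ (if there is no such $\boldsymbol k$, then $\Delta^i_{\min}=\infty$ and $\Delta^i_{\max}=0$). Let $\Delta_{\max}=\max_i\Delta^i_{\max}$. **Revised CLCB algorithm (non-adaptive exploration).** Let $\Phi_1,\Phi_2,\dots$ be independent random realizations. Start with $T_i=0$ and $\hat\mu_i=0$ for all $i$. In round $t=1,2,\dots$: 1. For each $i$ put $\rho_i=\sqrt{3\ln t/(2T_i)}$ (with $\rho_i=0$ if $T_i=0$) and $\underline{\mu}_i=\max\{0,\hat\mu_i-\rho_i\}$. 2. Choose $\boldsymbol k_t$ by the greedy method: start with $\boldsymbol k=0$ and, $K$ times, increase $k_{i}$ by one for some $i\in\arg\max_j(1-\underline{\mu}_j)^{k_j}$. Ties may be broken by any rule, possibly randomized, that does not depend on $\Phi_t,\Phi_{t+1},\dots$ and under which every community is explored at least once in the round, i.e. $k_{i,t}\ge 1$ for all $i$. 3. Explore each $C_i$ for $k_{i,t}$ times and meet $u_x=\Phi_t(i,x)$, $1\le x\le k_{i,t}$. For each $i$ with $k_{i,t}>1$ let $X_{i,t}=\frac{1}{\lfloor k_{i,t}/2\rfloor}\sum_{x=1}^{\lfloor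 k_{i,t}/2\rfloor}\mathbf 1\{u_{2x-1}=u_{2x}\}$, and update $T_i\leftarrow T_i+1$ and then $\hat\mu_i\leftarrow\hat\mu_i+(X_{i,t}-\hat\mu_i)/T_i$. The regret is $\mathrm{Reg}^r(T)=\mathbb{E}\left[\sum_{t=1}^T\left(R(\boldsymbol k^*,\Phi_t)-R(\boldsymbol k_t,\Phi_t)\right)\right]$. **Theorem.** For every $T\ge 1$, $$\mathrm{Reg}^r(T)\le\sum_{i=1}^m\frac{48\binom{K'}{2}^2\ln T}{\Delta^i_{\min}}+2\binom{K'}{2}m+\frac{\pi^2}{3}\,m\,\Delta_{\max},$$ where a summand with $\Delta^i_{\min}=\infty$ is $0$. -/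

import Mathlib

open MeasureTheory ProbabilityTheory

noncomputable section

namespace CommunityExploration

/-- A realization of the explorations of one round: community `i` has the members `Fin (d i)`, and
`φ i τ` is the member met in the exploration number `τ + 1` of community `i`. -/
abbrev Realization {m : ℕ} (K : ℕ) (d : Fin m → ℕ) : Type :=
  (i : Fin m) → Fin K → Fin (d i)

/-- The law of a random realization: all the members met are independent, and those met in
community `i` are uniform on `Fin (d i)`. -/
def realizationLaw {m : ℕ} (K : ℕ) (d : Fin m → ℕ) : Measure (Realization K d) :=
  Measure.pi fun i => Measure.pi fun _ : Fin K => (uniformOn Set.univ : Measure (Fin (d i)))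

/-- The sequences of members met in each community when community `i` is explored `k i` times. -/
def feedback {m K : ℕ} {d : Fin m → ℕ} (k : Fin m → ℕ) (φ : Realization K d) (i : Fin m) :
    List (Fin (d i)) :=
  (List.ofFn (φ i)).take (k i)

/-- The number of distinct members met. -/
def reward {m K : ℕ} {d : Fin m → ℕ} (k : Fin m → ℕ) (φ : Realization K d) : ℕ :=
  ∑ i, (feedback k φ i).toFinset.card

/-- The expected reward of a budget allocation. -/
def expectedReward {m : ℕ} (K : ℕ) (d : Fin m → ℕ) (k : Fin m → ℕ) : ℝ :=
  ∫ φ, (reward k φ : ℝ) ∂(realizationLaw K d)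

/-- `k` maximizes the expected reward among the allocations of total budget at most `K`. -/
def IsOptimalAllocation {m : ℕ} (K : ℕ) (d : Fin m → ℕ) (k : Fin m → ℕ) : Prop :=
  ∑ i, k i ≤ K ∧
    ∀ k' : Fin m → ℕ, ∑ i, k' i ≤ K → expectedReward K d k' ≤ expectedReward K d k

/-- The gap of the action `k` with respect to the optimal allocation `kstar`. -/
def gap {m : ℕ} (K : ℕ) (d : Fin m → ℕ) (kstar k : Fin m → ℕ) : ℝ :=
  expectedReward K d kstar - expectedReward K d k

/-- The actions of total budget `K` with positive gap which explore community `i` more than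
once. -/
def badActions {m : ℕ} (K : ℕ) (d : Fin m → ℕ) (kstar : Fin m → ℕ) (i : Fin m) :
    Set (Fin m → ℕ) :=
  {k | ∑ j, k j = K ∧ 0 < gap K d kstar k ∧ 1 < k i}

/-- The smallest gap of a bad action of community `i`; it is `⊤` if there is none. -/
def gapMin {m : ℕ} (K : ℕ) (d : Fin m → ℕ) (kstar : Fin m → ℕ) (i : Fin m) : EReal :=
  ⨅ k ∈ badActions K d kstar i, ((gap K d kstar k : ℝ) : EReal)

/-- The largest gap of a bad action of community `i` (there are finitely many bad actions); it is
`0` if there is none. -/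
def gapMaxAt {m : ℕ} (K : ℕ) (d : Fin m → ℕ) (kstar : Fin m → ℕ) (i : Fin m) : ℝ :=
  sSup (gap K d kstar '' badActions K d kstar i)

/-- The largest of the numbers `gapMaxAt K d kstar i`. -/
def gapMax {m : ℕ} (K : ℕ) (d : Fin m → ℕ) (kstar : Fin m → ℕ) : ℝ :=
  ⨆ i, gapMaxAt K d kstar i

/-- `GreedyAllocation μ s k`: the greedy method run for `s` steps with the parameters `μ` can
return the allocation `k`. Each step gives one more exploration to some community `i` that
maximizes `(1 - μ i) ^ k i`; any tie-breaking is allowed. -/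
inductive GreedyAllocation {m : ℕ} (μ : Fin m → ℝ) : ℕ → (Fin m → ℕ) → Prop
  | zero : GreedyAllocation μ 0 (fun _ => 0)
  | step {s : ℕ} {k : Fin m → ℕ} {i : Fin m} (h : GreedyAllocation μ s k)
      (hi : ∀ j, (1 - μ j) ^ k j ≤ (1 - μ i) ^ k i) :
      GreedyAllocation μ (s + 1) (Function.update k i (k i + 1))

/-- The fraction of collisions among the `⌊|S| / 2⌋` disjoint consecutive pairs of `S`. -/
def collisionAverage {α : Type*} [DecidableEq α] (S : List α) : ℝ :=
  (∑ x ∈ Finset.range (S.length / 2), if S[2 * x]? = S[2 * x + 1]? then (1 : ℝ) else 0) /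
    ((S.length / 2 : ℕ) : ℝ)

/-- The memory of the learner: for each community the number of observations and the empirical
mean. -/
structure LearnerState (m : ℕ) where
  count : Fin m → ℕ
  mean : Fin m → ℝ

/-- The initial memory. -/
def LearnerState.init (m : ℕ) : LearnerState m where
  count := fun _ => 0
  mean := fun _ => 0

/-- The update of the revised algorithm: one averaged observation for each community in which at
least two members were met. -/
def LearnerState.update {m : ℕ} {d : Fin m → ℕ} (σ : LearnerState m)
    (S : (i : Fin m) → List (Fin (d i))) : LearnerState m where
  count := fun i => σ.count i + if 1 < (S i).length then 1 else 0
  mean := fun i =>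
    if 1 < (S i).length then
      σ.mean i + (collisionAverage (S i) - σ.mean i) / ((σ.count i + 1 : ℕ) : ℝ)
    else σ.mean i

/-- The confidence radius used in round `t`. -/
def LearnerState.radius {m : ℕ} (σ : LearnerState m) (t : ℕ) (i : Fin m) : ℝ :=
  if σ.count i = 0 then 0 else Real.sqrt (3 * Real.log t / (2 * σ.count i))

/-- The lower confidence bound used in round `t`. -/
def LearnerState.lcb {m : ℕ} (σ : LearnerState m) (t : ℕ) (i : Fin m) : ℝ :=
  max 0 (σ.mean i - σ.radius t i)

/-- The memory at the end of round `t`, when the rounds `1, 2, …` are played with the allocations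
`k 1, k 2, …` and the realizations `φ 1, φ 2, …`. -/
def stateAfter {m K : ℕ} {d : Fin m → ℕ} (k : ℕ → Fin m → ℕ) (φ : ℕ → Realization K d) :
    ℕ → LearnerState m
  | 0 => LearnerState.init m
  | t + 1 => (stateAfter k φ t).update (feedback (k (t + 1)) (φ (t + 1)))

/-- The online environment: `ℱ t` is the information available at the end of round `t` (it may
include the internal randomness of the learner), the realization `Φ (t + 1)` of round `t + 1` is
revealed in that round, is independent of the past, and has the law `realizationLaw K d`. -/
structure IsOnlineEnvironment {m K : ℕ} (d : Fin m → ℕ) {Ω : Type*} {mΩ : MeasurableSpace Ω}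
    (P : Measure Ω) (ℱ : Filtration ℕ mΩ) (Φ : ℕ → Ω → Realization K d) : Prop where
  adapted : ∀ t, Measurable[ℱ (t + 1)] (Φ (t + 1))
  indep : ∀ t, Indep (ℱ t) (MeasurableSpace.comap (Φ (t + 1)) inferInstance) P
  law : ∀ t, P.map (Φ (t + 1)) = realizationLaw K d

/-- The allocations `k 1, k 2, …` are chosen by the revised CLCB algorithm with the non-adaptive
exploration method. The ties in the greedy method are broken by any rule, possibly randomized, that
does not look at the future and lets every community be explored at least once in each round. -/
structure IsRevisedCLCB {m K : ℕ} {d : Fin m → ℕ} {Ω : Type*} {mΩ : MeasurableSpace Ω}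
    (ℱ : Filtration ℕ mΩ) (Φ : ℕ → Ω → Realization K d) (k : ℕ → Ω → Fin m → ℕ) : Prop where
  nonanticipating : ∀ t, Measurable[ℱ t] (k (t + 1))
  greedy : ∀ t ω,
    GreedyAllocation ((stateAfter (fun s => k s ω) (fun s => Φ s ω) t).lcb (t + 1)) K (k (t + 1) ω)
  explores : ∀ t ω i, 1 ≤ k (t + 1) ω i

/-- The regret of the allocations `k 1, …, k T` with respect to the optimal allocation `kstar`. -/
def regret {m K : ℕ} {d : Fin m → ℕ} {Ω : Type*} {mΩ : MeasurableSpace Ω} (P : Measure Ω)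
    (Φ : ℕ → Ω → Realization K d) (kstar : Fin m → ℕ) (k : ℕ → Ω → Fin m → ℕ) (T : ℕ) : ℝ :=
  ∫ ω, ∑ t ∈ Finset.Icc 1 T,
    ((reward kstar (Φ t ω) : ℝ) - (reward (k t ω) (Φ t ω) : ℝ)) ∂P

end CommunityExploration

end

/-! The expected reward is `∑ i, ∑ j < k i, (1 - 1 / d i) ^ j`: it is separable with decreasing
marginal gains, so the greedy method maximizes it for any parameters in `[0, 1]`
(`GreedyAllocation.sum_geom_le`). When all lower confidence bounds lie below `1 / d i`, optimism
bounds the gap of the chosen allocation by the widths of the bounds, weighted by `(k i).choose 2`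
(`gap_le_sum_choose_two`). The weights sum to at most `B = (K - m + 1).choose 2`, because every
community is explored (`sum_choose_two_le`).

The gap `g` is then rewritten as `2 * g - g`, and the subtracted `g` is spread over the communities
in proportion to the weights. A community pays only while twice its width exceeds `g / B`
(`gap_le_sum_charge`). The charge depends only on its number of observations, which runs through `0,
1, 2, …`, so on each sample path the charges sum to `O(B ^ 2 * log T / Δ)`, plus `2 * B` for the
round without data (`sum_comp_count`, `sum_charge_le`).

The number of observations is random and depends on the past. The confidence bounds therefore rest
on an exponential supermartingale (`lintegral_expDeviation_le`), Markov's inequality and a union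
bound over the possible sample sizes. Round `t` fails with probability at most `2 * m / t ^ 2`, each
failure costs at most `gapMax`, and the sum over `t` gives the `π ^ 2 / 3` term. -/

namespace CommunityExploration

/-! ### Independent uniform draws: collisions and distinct values. -/

section Uniform

variable {K n : ℕ}

/-- The law of `K` independent uniform draws from `Fin n`. -/
noncomputable abbrev drawLaw (K n : ℕ) : Measure (Fin K → Fin n) :=
  Measure.pi fun _ : Fin K => (uniformOn Set.univ : Measure (Fin n))

theorem uniformOn_univ_real_singleton (v : Fin n) :
    (uniformOn Set.univ : Measure (Fin n)).real {v} = 1 / n := by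
  rw [measureReal_def, uniformOn_univ, Measure.count_singleton]
  simp

theorem drawLaw_real_pi (s : Fin K → Set (Fin n)) :
    (drawLaw K n).real (Set.univ.pi s) =
      ∏ j, (uniformOn Set.univ : Measure (Fin n)).real (s j) := by
  simp only [measureReal_def, drawLaw, Measure.pi_pi, ENNReal.toReal_prod]

theorem drawLaw_real_collision [NeZero n] {a b : Fin K} (hab : a ≠ b) :
    (drawLaw K n).real {f | f a = f b} = 1 / n := by
  -- The collision is split according to the common value `v`; each of the `n` pieces has
  -- probability `(1 / n) ^ 2`.
  have hset : {f : Fin K → Fin n | f a = f b} = ⋃ v : Fin n,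
      Set.univ.pi fun j => if j = a ∨ j = b then {v} else Set.univ := by
    ext f
    simp only [Set.mem_ofPred_eq, Set.mem_iUnion, Set.mem_pi, Set.mem_univ, true_implies]
    constructor
    · intro h
      refine ⟨f a, fun j => ?_⟩
      split_ifs with hj
      · rcases hj with rfl | rfl <;> simp [h]
      · trivial
    · rintro ⟨v, hv⟩
      have ha := hv a
      have hb := hv b
      simp at ha hb
      rw [ha, hb]
  have hdisj : Pairwise (Function.onFun Disjoint fun v : Fin n =>
      (Set.univ.pi fun j : Fin K => if j = a ∨ j = b then {v} else Set.univ)) := by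
    intro v w hvw
    refine Set.disjoint_left.2 fun f hf hf' => hvw ?_
    have h1 := hf a trivial
    have h2 := hf' a trivial
    simp at h1 h2
    rw [← h1, ← h2]
  rw [hset, measureReal_iUnion_fintype hdisj fun _ => MeasurableSet.of_discrete]
  have hv : ∀ v : Fin n, (drawLaw K n).real
      (Set.univ.pi fun j => if j = a ∨ j = b then {v} else Set.univ) = (1 / n) ^ 2 := by
    intro v
    rw [drawLaw_real_pi]
    have : ∀ j : Fin K, (uniformOn Set.univ : Measure (Fin n)).real
        (if j = a ∨ j = b then {v} else Set.univ) =
        (if j = a then (1 / n : ℝ) else 1) * (if j = b then (1 / n : ℝ) else 1) := by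
      intro j
      by_cases h1 : j = a
      · subst h1
        simp only [true_or, if_true, hab, if_false, uniformOn_univ_real_singleton, mul_one]
      · by_cases h2 : j = b
        · subst h2
          simp only [or_true, if_true, h1, if_false, uniformOn_univ_real_singleton, one_mul]
        · simp [h1, h2]
    simp only [this, Finset.prod_mul_distrib, Finset.prod_ite_eq', Finset.mem_univ, if_true]
    ring
  simp only [hv, Finset.sum_const, Finset.card_univ, Fintype.card_fin, nsmul_eq_mul]
  have : (n : ℝ) ≠ 0 := Nat.cast_ne_zero.2 (NeZero.ne n)
  field_simp

theorem drawLaw_real_missed [NeZero n] {k : ℕ} (hk : k ≤ K) (v : Fin n) :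
    (drawLaw K n).real {f | ∀ j : Fin K, (j : ℕ) < k → f j ≠ v} = (1 - 1 / (n : ℝ)) ^ k := by
  have hset : {f : Fin K → Fin n | ∀ j : Fin K, (j : ℕ) < k → f j ≠ v} =
      Set.univ.pi fun j : Fin K => if (j : ℕ) < k then {v}ᶜ else Set.univ := by
    ext f
    simp only [Set.mem_ofPred_eq, Set.mem_pi, Set.mem_univ, true_implies]
    refine forall_congr' fun j => ?_
    split_ifs with hj <;> simp [hj]
  have hprod : ∀ j : Fin K, (uniformOn Set.univ : Measure (Fin n)).real
      (if (j : ℕ) < k then {v}ᶜ else Set.univ) =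
        if (j : ℕ) < k then (1 - 1 / (n : ℝ)) else 1 := by
    intro j
    split_ifs
    · rw [probReal_compl_eq_one_sub MeasurableSet.of_discrete, uniformOn_univ_real_singleton]
    · simp
  rw [hset, drawLaw_real_pi]
  simp only [hprod]
  rw [Fin.prod_univ_eq_prod_range (fun j => if j < k then (1 - 1 / (n : ℝ)) else 1) K,
    Finset.prod_ite, Finset.prod_const_one, mul_one, Finset.prod_const]
  congr 1
  conv_rhs => rw [← Finset.card_range k]
  congr 1
  ext j
  simp only [Finset.mem_filter, Finset.mem_range]
  omega

theorem mem_take_ofFn {k : ℕ} (f : Fin K → Fin n) (v : Fin n) :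
    v ∈ (List.ofFn f).take k ↔ ∃ j : Fin K, (j : ℕ) < k ∧ f j = v := by
  rw [List.mem_take_iff_getElem]
  constructor
  · rintro ⟨i, hi, rfl⟩
    simp only [List.length_ofFn, lt_min_iff] at hi
    exact ⟨⟨i, hi.2⟩, hi.1, by simp⟩
  · rintro ⟨j, hj, rfl⟩
    exact ⟨j, by simp [hj], by simp⟩

/-- Each value is missed with probability `(1 - 1 / n) ^ k`, so linearity gives `n * (1 - (1 - 1 /
n) ^ k)`, which is a geometric sum. Its terms are the marginal gains of the greedy method. -/
theorem integral_card_distinct [NeZero n] {k : ℕ} (hk : k ≤ K) :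
    ∫ f, ((((List.ofFn f).take k).toFinset.card : ℕ) : ℝ) ∂(drawLaw K n) =
      ∑ j ∈ Finset.range k, (1 - 1 / (n : ℝ)) ^ j := by
  have hcard : ∀ f : Fin K → Fin n, ((((List.ofFn f).take k).toFinset.card : ℕ) : ℝ) =
      ∑ v : Fin n, Set.indicator {g : Fin K → Fin n | ∀ j : Fin K, (j : ℕ) < k → g j ≠ v}ᶜ
        (fun _ => (1 : ℝ)) f := by
    intro f
    simp only [Set.indicator_apply, Set.mem_compl_iff, Set.mem_ofPred_eq, Finset.sum_boole]
    congr 2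
    ext v
    simp [mem_take_ofFn]
  have hn : (n : ℝ) ≠ 0 := Nat.cast_ne_zero.2 (NeZero.ne n)
  simp only [hcard]
  rw [integral_finsetSum _ fun v _ => Integrable.of_finite]
  have hv : ∀ v : Fin n, ∫ f, Set.indicator
      {g : Fin K → Fin n | ∀ j : Fin K, (j : ℕ) < k → g j ≠ v}ᶜ (fun _ => (1 : ℝ)) f
        ∂(drawLaw K n) = 1 - (1 - 1 / (n : ℝ)) ^ k := by
    intro v
    rw [integral_indicator_const _ MeasurableSet.of_discrete,
      probReal_compl_eq_one_sub MeasurableSet.of_discrete, drawLaw_real_missed hk, smul_eq_mul,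
      mul_one]
  simp only [hv, Finset.sum_const, Finset.card_univ, Fintype.card_fin, nsmul_eq_mul]
  rw [← geom_sum_mul_neg]
  field_simp
  ring

theorem length_take_ofFn {α : Type*} {k : ℕ} (hk : k ≤ K) (f : Fin K → α) :
    ((List.ofFn f).take k).length = k := by
  simp [hk]

theorem collisionAverage_mem_Icc {α : Type*} [DecidableEq α] (S : List α) :
    collisionAverage S ∈ Set.Icc (0 : ℝ) 1 := by
  unfold collisionAverage
  constructor
  · exact div_nonneg (Finset.sum_nonneg fun _ _ => by split_ifs <;> norm_num) (Nat.cast_nonneg _)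
  · refine div_le_one_of_le₀ ?_ (Nat.cast_nonneg _)
    calc _ ≤ ∑ x ∈ Finset.range (S.length / 2), (1 : ℝ) :=
          Finset.sum_le_sum fun _ _ => by split_ifs <;> norm_num
      _ = _ := by simp

theorem integral_collisionAverage [NeZero n] {k : ℕ} (hk : k ≤ K) (h2 : 1 < k) :
    ∫ f, collisionAverage ((List.ofFn f).take k) ∂(drawLaw K n) = 1 / n := by
  simp only [collisionAverage, length_take_ofFn hk]
  rw [integral_div, integral_finsetSum _ fun v _ => Integrable.of_finite]
  have hx : ∀ x ∈ Finset.range (k / 2), ∫ f : Fin K → Fin n,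
      (if ((List.ofFn f).take k)[2 * x]? = ((List.ofFn f).take k)[2 * x + 1]? then (1 : ℝ) else 0)
        ∂(drawLaw K n) = 1 / n := by
    intro x hx
    rw [Finset.mem_range] at hx
    have h1 : 2 * x < K := by omega
    have h3 : 2 * x + 1 < K := by omega
    rw [← drawLaw_real_collision (n := n) (a := ⟨2 * x, h1⟩) (b := ⟨2 * x + 1, h3⟩) (by simp)]
    rw [← integral_indicator_one MeasurableSet.of_discrete]
    congr 1
    ext f
    rw [List.getElem?_take_of_lt (by omega), List.getElem?_take_of_lt (by omega)]
    simp [Set.indicator_apply, h1, h3]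
  rw [Finset.sum_congr rfl hx]
  have : ((k / 2 : ℕ) : ℝ) ≠ 0 := Nat.cast_ne_zero.2 (by omega)
  simp only [Finset.sum_const, Finset.card_range, nsmul_eq_mul]
  field_simp

/-- Hoeffding's lemma for a variable in `[0, 1]`, whose variance proxy `1 / 4` gives `l ^ 2 / 8`.
The whole average counts as one bounded observation; the independence of its pairs brings no gain
here. -/
theorem lintegral_exp_collisionAverage_le [NeZero n] {k : ℕ} (hk : k ≤ K) (h2 : 1 < k) (l : ℝ) :
    ∫⁻ f, ENNReal.ofReal
      (Real.exp (l * (collisionAverage ((List.ofFn f).take k) - 1 / n) - l ^ 2 / 8))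
        ∂(drawLaw K n) ≤ 1 := by
  have hsub := hasSubgaussianMGF_of_mem_Icc (μ := drawLaw K n)
    (X := fun f => collisionAverage ((List.ofFn f).take k)) (a := 0) (b := 1)
    (Measurable.of_discrete.aemeasurable) (ae_of_all _ fun f => collisionAverage_mem_Icc _)
  have hm := hsub.mgf_le l
  simp only [mgf, integral_collisionAverage hk h2] at hm
  rw [← ofReal_integral_eq_lintegral_ofReal Integrable.of_finite
    (ae_of_all _ fun _ => (Real.exp_pos _).le)]
  rw [← ENNReal.ofReal_one]
  refine ENNReal.ofReal_le_ofReal ?_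
  simp only [Real.exp_sub]
  rw [integral_div, div_le_one (Real.exp_pos _)]
  refine hm.trans (le_of_eq ?_)
  congr 1
  simp
  ring

end Uniform

/-! ### Transfer from one community to the full realization. -/

section Law

variable {m K : ℕ} {d : Fin m → ℕ} [∀ i, NeZero (d i)]

instance : IsProbabilityMeasure (realizationLaw K d) := by
  unfold realizationLaw
  infer_instance

theorem measurePreserving_eval_realizationLaw (i : Fin m) :
    MeasurePreserving (Function.eval i) (realizationLaw K d) (drawLaw K (d i)) :=
  measurePreserving_eval _ i

theorem expectedReward_eq {k : Fin m → ℕ} (hk : ∀ i, k i ≤ K) :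
    expectedReward K d k = ∑ i, ∑ j ∈ Finset.range (k i), (1 - 1 / (d i : ℝ)) ^ j := by
  unfold expectedReward reward feedback
  push_cast
  rw [integral_finsetSum _ fun v _ => Integrable.of_finite]
  refine Finset.sum_congr rfl fun i _ => ?_
  rw [← integral_card_distinct (hk i),
    ← (measurePreserving_eval_realizationLaw (K := K) (d := d) i).map_eq,
    integral_map (Measurable.of_discrete.aemeasurable) (Measurable.of_discrete.aestronglyMeasurable)]

theorem lintegral_exp_feedback_le {k : Fin m → ℕ} {i : Fin m} (hk : k i ≤ K) (h2 : 1 < k i)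
    (l : ℝ) :
    ∫⁻ φ, ENNReal.ofReal
      (Real.exp (l * (collisionAverage (feedback k φ i) - 1 / d i) - l ^ 2 / 8))
        ∂(realizationLaw K d) ≤ 1 := by
  refine le_trans (le_of_eq ?_) (lintegral_exp_collisionAverage_le (n := d i) hk h2 l)
  rw [← (measurePreserving_eval_realizationLaw (K := K) (d := d) i).map_eq,
    lintegral_map Measurable.of_discrete Measurable.of_discrete]
  rfl

end Law

/-! ### Optimality of the greedy method. -/

section Greedy

variable {m : ℕ} {μ : Fin m → ℝ}

theorem GreedyAllocation.sum_eq {s : ℕ} {k : Fin m → ℕ} (h : GreedyAllocation μ s k) :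
    ∑ i, k i = s := by
  induction h with
  | zero => simp
  | @step s k i h hi ih =>
    rw [Finset.sum_update_of_mem (Finset.mem_univ i), ← ih,
      ← Finset.add_sum_erase _ _ (Finset.mem_univ i), Finset.sdiff_singleton_eq_erase]
    ring

/-- The marginal gains that the greedy method leaves are at most those that it has taken. -/
theorem GreedyAllocation.pow_le_pow (h0 : ∀ i, 0 ≤ μ i) (h1 : ∀ i, μ i ≤ 1) {s : ℕ}
    {k : Fin m → ℕ} (h : GreedyAllocation μ s k) :
    ∀ i j, 0 < k i → (1 - μ j) ^ k j ≤ (1 - μ i) ^ (k i - 1) := by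
  have hdec : ∀ j n, (1 - μ j) ^ (n + 1) ≤ (1 - μ j) ^ n := fun j n =>
    pow_le_pow_of_le_one (sub_nonneg.2 (h1 j)) (sub_le_self _ (h0 j)) (Nat.le_succ n)
  induction h with
  | zero => intro i j hi; exact absurd hi (lt_irrefl 0)
  | @step s k i h hi ih =>
    intro a b ha
    have hb : (1 - μ b) ^ (Function.update k i (k i + 1) b) ≤ (1 - μ b) ^ k b := by
      by_cases hbi : b = i
      · subst hbi
        simpa using hdec b (k b)
      · rw [Function.update_of_ne hbi]
    refine hb.trans ?_
    -- The gain just taken was maximal when taken; the older ones are covered by induction, since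
    -- the gains left only decrease.
    by_cases hai : a = i
    · subst hai
      simpa using hi b
    · rw [Function.update_of_ne hai] at ha ⊢
      exact ih a b ha

/-- Exchange against a threshold: the largest gain `θ` left is at most every gain taken. Passing to
`k'` thus adds at most `θ` per extra exploration and loses at least `θ` per dropped one, and `k'`
does not spend more in total. -/
theorem GreedyAllocation.sum_geom_le (h0 : ∀ i, 0 ≤ μ i) (h1 : ∀ i, μ i ≤ 1) {s : ℕ}
    {k : Fin m → ℕ} (h : GreedyAllocation μ s k) {k' : Fin m → ℕ} (hk' : ∑ i, k' i ≤ s) :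
    ∑ i, ∑ j ∈ Finset.range (k' i), (1 - μ i) ^ j ≤
      ∑ i, ∑ j ∈ Finset.range (k i), (1 - μ i) ^ j := by
  rcases isEmpty_or_nonempty (Fin m) with hm | hm
  · simp
  obtain ⟨a, ha⟩ := Finite.exists_max fun i => (1 - μ i) ^ k i
  set θ := (1 - μ a) ^ k a with hθ
  have hθ0 : 0 ≤ θ := pow_nonneg (sub_nonneg.2 (h1 a)) _
  have hq0 : ∀ i, 0 ≤ 1 - μ i := fun i => sub_nonneg.2 (h1 i)
  have hq1 : ∀ i, 1 - μ i ≤ 1 := fun i => sub_le_self _ (h0 i)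
  have hkey : ∀ i, ∑ j ∈ Finset.range (k' i), (1 - μ i) ^ j ≤
      ∑ j ∈ Finset.range (k i), (1 - μ i) ^ j + θ * ((k' i : ℝ) - k i) := by
    intro i
    rcases le_total (k i) (k' i) with hle | hle
    · rw [← Finset.sum_range_add_sum_Ico _ hle]
      have : ∑ j ∈ Finset.Ico (k i) (k' i), (1 - μ i) ^ j ≤
          ∑ j ∈ Finset.Ico (k i) (k' i), θ := Finset.sum_le_sum fun j hj =>
        (pow_le_pow_of_le_one (hq0 i) (hq1 i) (Finset.mem_Ico.1 hj).1).trans (ha i)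
      rw [Finset.sum_const, Nat.card_Ico, nsmul_eq_mul, Nat.cast_sub hle] at this
      linarith
    · rw [← Finset.sum_range_add_sum_Ico _ hle]
      have : ∑ j ∈ Finset.Ico (k' i) (k i), θ ≤
          ∑ j ∈ Finset.Ico (k' i) (k i), (1 - μ i) ^ j := Finset.sum_le_sum fun j hj => by
        have hj := Finset.mem_Ico.1 hj
        exact (h.pow_le_pow h0 h1 i a (by omega)).trans
          (pow_le_pow_of_le_one (hq0 i) (hq1 i) (by omega))
      rw [Finset.sum_const, Nat.card_Ico, nsmul_eq_mul, Nat.cast_sub hle] at this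
      linarith
  have hsum : (∑ i, (k' i : ℝ)) ≤ ∑ i, (k i : ℝ) := by
    exact_mod_cast hk'.trans_eq h.sum_eq.symm
  calc _ ≤ ∑ i, (∑ j ∈ Finset.range (k i), (1 - μ i) ^ j + θ * ((k' i : ℝ) - k i)) :=
        Finset.sum_le_sum fun i _ => hkey i
    _ = ∑ i, ∑ j ∈ Finset.range (k i), (1 - μ i) ^ j +
        θ * (∑ i, (k' i : ℝ) - ∑ i, (k i : ℝ)) := by
      rw [Finset.sum_add_distrib, ← Finset.mul_sum, Finset.sum_sub_distrib]
    _ ≤ _ := by nlinarith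

end Greedy

/-! ### Elementary inequalities. -/

/-- Lowering the collision probability raises a sum of marginal gains at most linearly. -/
theorem sum_geom_sub_le {a b : ℝ} (ha : 0 ≤ a) (hab : a ≤ b) (hb : b ≤ 1) (n : ℕ) :
    ∑ j ∈ Finset.range n, (1 - a) ^ j - ∑ j ∈ Finset.range n, (1 - b) ^ j ≤
      (n.choose 2 : ℕ) * (b - a) := by
  -- Summing the factors `j` over `j < n` produces `n.choose 2`.
  have hpow : ∀ j : ℕ, (1 - a) ^ j - (1 - b) ^ j ≤ j * (b - a) := by
    intro j
    induction j with
    | zero => simp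
    | succ j ih =>
      have h1 : (1 - a) ^ j ≤ 1 := pow_le_one₀ (by linarith) (by linarith)
      have h2 : (1 - b) * ((1 - a) ^ j - (1 - b) ^ j) ≤ (1 - b) * (j * (b - a)) :=
        mul_le_mul_of_nonneg_left ih (by linarith)
      have h3 : (1 - b) * (j * (b - a)) ≤ j * (b - a) :=
        mul_le_of_le_one_left (mul_nonneg (Nat.cast_nonneg _) (by linarith)) (by linarith)
      have h4 : (b - a) * (1 - a) ^ j ≤ b - a :=
        mul_le_of_le_one_right (by linarith) h1
      push_cast
      rw [pow_succ, pow_succ]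
      nlinarith
  rw [← Finset.sum_sub_distrib, Nat.choose_two_right, ← Finset.sum_range_id]
  push_cast
  rw [Finset.sum_mul]
  exact Finset.sum_le_sum fun j _ => hpow j

theorem sum_geom_antitone {a b : ℝ} (hab : a ≤ b) (hb : b ≤ 1) (n : ℕ) :
    ∑ j ∈ Finset.range n, (1 - b) ^ j ≤ ∑ j ∈ Finset.range n, (1 - a) ^ j :=
  Finset.sum_le_sum fun j _ => pow_le_pow_left₀ (by linarith) (by linarith) j

theorem choose_two_add_choose_two_le (a b : ℕ) :
    (a + 1).choose 2 + (b + 1).choose 2 ≤ (a + b + 1).choose 2 := by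
  induction b with
  | zero => simp
  | succ b ih =>
    have h1 : (b + 1 + 1).choose 2 = (b + 1) + (b + 1).choose 2 := by
      rw [Nat.choose_succ_succ' (b + 1) 1, Nat.choose_one_right]
    have h2 : (a + (b + 1) + 1).choose 2 = (a + b + 1) + (a + b + 1).choose 2 := by
      rw [← add_assoc, Nat.choose_succ_succ' (a + b + 1) 1, Nat.choose_one_right]
    omega

/-- The map `x ↦ (x + 1).choose 2` is superadditive, and the excesses `k i - 1` sum to `K - m`. -/
theorem sum_choose_two_le {m K : ℕ} {k : Fin m → ℕ} (hk : ∑ i, k i = K) (h1 : ∀ i, 1 ≤ k i) :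
    ∑ i, (k i).choose 2 ≤ (K - m + 1).choose 2 := by
  have hgen : ∀ s : Finset (Fin m),
      ∑ i ∈ s, (k i).choose 2 ≤ (∑ i ∈ s, (k i - 1) + 1).choose 2 := by
    intro s
    induction s using Finset.induction_on with
    | empty => simp
    | insert a s ha ih =>
      rw [Finset.sum_insert ha, Finset.sum_insert ha]
      refine le_trans ?_ (choose_two_add_choose_two_le _ _)
      rw [Nat.sub_add_cancel (h1 a)]
      exact Nat.add_le_add_left ih _
  refine (hgen Finset.univ).trans (Nat.choose_le_choose 2 ?_)
  have : ∑ i, k i = ∑ i, (k i - 1) + m := by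
    conv_rhs => rhs; rw [← Finset.card_fin m, Finset.card_eq_sum_ones]
    rw [← Finset.sum_add_distrib]
    exact Finset.sum_congr rfl fun i _ => (Nat.sub_add_cancel (h1 i)).symm
  omega

/-- The positive parts of `a / √s - M` sum up to at most `a ^ 2 / M`. -/
theorem sum_max_div_sqrt_sub_le {a M : ℝ} (ha : 0 ≤ a) (hM : 0 < M) (N : ℕ) :
    ∑ s ∈ Finset.range N, max 0 (a / √((s + 1 : ℕ) : ℝ) - M) ≤ a ^ 2 / M := by
  -- The right side is the integral of `max 0 (a / √u - M)` over `0 ≤ u ≤ N`, whose integrand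
  -- vanishes beyond `√u = a / M`. It is at most `a ^ 2 / M` by completing the square.
  have hgen : ∑ s ∈ Finset.range N, max 0 (a / √((s + 1 : ℕ) : ℝ) - M) ≤
      2 * a * min (√N) (a / M) - M * min (√N) (a / M) ^ 2 := by
    induction N with
    | zero =>
      have : (0 : ℝ) ≤ a / M := by positivity
      simp [this]
    | succ N ih =>
      rw [Finset.sum_range_succ]
      set x := √(N : ℝ) with hx
      set y := √((N + 1 : ℕ) : ℝ) with hy
      have hx0 : 0 ≤ x := Real.sqrt_nonneg _
      have hy0 : 0 < y := Real.sqrt_pos.2 (by positivity)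
      have hxx : x ^ 2 = N := Real.sq_sqrt (Nat.cast_nonneg _)
      have hyy : y ^ 2 = N + 1 := by rw [hy, Real.sq_sqrt (by positivity)]; push_cast; ring
      have hxy : x ≤ y := Real.sqrt_le_sqrt (by push_cast; linarith)
      have hac : a = M * (a / M) := by field_simp
      set c := a / M with hc
      have hc0 : 0 ≤ c := by positivity
      rcases le_total y c with hyc | hyc
      · rw [min_eq_left hyc]
        rw [min_eq_left (hxy.trans hyc)] at ih
        have h1 : 0 ≤ a / y - M := by
          rw [sub_nonneg, le_div_iff₀ hy0, hac]
          exact mul_le_mul_of_nonneg_left hyc hM.le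
        rw [max_eq_right h1]
        have h2 : a / y ≤ 2 * a * (y - x) := by
          rw [div_le_iff₀ hy0]
          have : 1 ≤ 2 * (y - x) * y := by nlinarith
          nlinarith
        nlinarith
      · rw [min_eq_right hyc]
        have h1 : a / y - M ≤ 0 := by
          rw [sub_nonpos, div_le_iff₀ hy0, hac]
          exact mul_le_mul_of_nonneg_left hyc hM.le
        rw [max_eq_left h1]
        have h3 : min x c ≤ c := min_le_right _ _
        nlinarith [mul_nonneg hM.le (sq_nonneg (c - min x c))]
  refine hgen.trans ?_
  rw [le_div_iff₀ hM]
  nlinarith [sq_nonneg (a - M * min (√N) (a / M))]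

theorem sum_one_div_sq_le (T : ℕ) :
    ∑ t ∈ Finset.range T, 1 / ((t + 1 : ℕ) : ℝ) ^ 2 ≤ Real.pi ^ 2 / 6 := by
  have h := hasSum_zeta_two
  -- The term of index `0` is `1 / 0 ^ 2 = 0`, so the range may be shifted by one.
  have h2 := h.summable.sum_le_tsum (Finset.range (T + 1)) fun i _ => by positivity
  rw [h.tsum_eq, Finset.sum_range_succ'] at h2
  simpa using h2

/-! ### Conditioning on the past. -/

section Independence

variable {Ω A R : Type*} {𝒢 mΩ : MeasurableSpace Ω} [MeasurableSpace A] [Countable A]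
  [MeasurableSingletonClass A] [MeasurableSpace R]

/-- Integrating out a variable that is independent of the past. -/
theorem lintegral_mul_comp_of_indep {P : Measure Ω} (h𝒢 : 𝒢 ≤ mΩ)
    {k : Ω → A} {X : Ω → R} (hk : Measurable[𝒢] k) (hX : Measurable X)
    (hind : Indep 𝒢 (MeasurableSpace.comap X inferInstance) P) {W : Ω → ENNReal}
    (hW : Measurable[𝒢] W) {g : A → R → ENNReal} (hg : ∀ a, Measurable (g a)) :
    ∫⁻ ω, W ω * g (k ω) (X ω) ∂P = ∫⁻ ω, W ω * ∫⁻ x, g (k ω) x ∂(P.map X) ∂P := by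
  -- On each of the countably many events `k = a` the integrand is a function of the past times a
  -- function of `X`.
  have hsplit : ∀ (G : A → Ω → ENNReal) (ω : Ω),
      W ω * G (k ω) ω = ∑' a, (k ⁻¹' {a}).indicator W ω * G a ω := by
    intro G ω
    rw [tsum_eq_single (k ω)]
    · simp
    · intro a ha
      rw [Set.indicator_of_notMem (by simpa using ha.symm), zero_mul]
  have hWa : ∀ a, Measurable[𝒢] ((k ⁻¹' {a}).indicator W) := fun a =>
    hW.indicator (hk (measurableSet_singleton a))
  have h1 : ∀ ω, W ω * g (k ω) (X ω) = ∑' a, (k ⁻¹' {a}).indicator W ω * g a (X ω) :=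
    hsplit fun a ω => g a (X ω)
  have h2 : ∀ ω, W ω * ∫⁻ x, g (k ω) x ∂(P.map X) =
      ∑' a, (k ⁻¹' {a}).indicator W ω * ∫⁻ x, g a x ∂(P.map X) :=
    hsplit fun a _ => ∫⁻ x, g a x ∂(P.map X)
  simp only [h1, h2]
  have h3 : ∀ a, Measurable fun ω => (k ⁻¹' {a}).indicator W ω * g a (X ω) := fun a =>
    ((hWa a).mono h𝒢 le_rfl).mul ((hg a).comp hX)
  rw [lintegral_tsum fun a => (h3 a).aemeasurable,
    lintegral_tsum fun a => (((hWa a).mono h𝒢 le_rfl).mul_const _).aemeasurable]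
  refine tsum_congr fun a => ?_
  rw [lintegral_mul_const _ ((hWa a).mono h𝒢 le_rfl), lintegral_map (hg a) hX]
  exact lintegral_mul_eq_lintegral_mul_lintegral_of_independent_measurableSpace h𝒢
    hX.comap_le hind (hWa a) ((hg a).comp (comap_measurable X))

end Independence

/-! ### The learner's memory and concentration of its empirical means. -/

section State

variable {m K : ℕ} {d : Fin m → ℕ}

theorem length_feedback {k : Fin m → ℕ} {i : Fin m} (hk : k i ≤ K) (φ : Realization K d) :
    (feedback k φ i).length = k i := by
  simp [feedback, hk]

theorem measurable_update {Ω : Type*} [MeasurableSpace Ω] {σ : Ω → LearnerState m}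
    {k : Ω → Fin m → ℕ} {φ : Ω → Realization K d} {i : Fin m}
    (hσ : Measurable (fun ω => (σ ω).count i) ∧ Measurable (fun ω => (σ ω).mean i))
    (hk : Measurable k) (hφ : Measurable φ) :
    Measurable (fun ω => ((σ ω).update (feedback (k ω) (φ ω))).count i) ∧
      Measurable (fun ω => ((σ ω).update (feedback (k ω) (φ ω))).mean i) := by
  have hcomp : ∀ {B : Type} [MeasurableSpace B] (f : (Fin m → ℕ) → Realization K d → B),
      Measurable fun ω => f (k ω) (φ ω) := fun f =>
    (Measurable.of_discrete (f := fun p : (Fin m → ℕ) × Realization K d => f p.1 p.2)).comp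
      (hk.prodMk hφ)
  have hlen : MeasurableSet {ω | 1 < (feedback (k ω) (φ ω) i).length} :=
    measurableSet_lt measurable_const (hcomp fun a b => (feedback a b i).length)
  constructor
  · exact hσ.1.add (Measurable.ite hlen measurable_const measurable_const)
  · refine Measurable.ite hlen ?_ hσ.2
    refine hσ.2.add (((hcomp fun a b => collisionAverage (feedback a b i)).sub hσ.2).div ?_)
    exact (Measurable.of_discrete (f := fun n : ℕ => ((n + 1 : ℕ) : ℝ))).comp hσ.1

/-- The exponential of the centred observations, with Hoeffding's compensation. -/
noncomputable def expDeviation (d : Fin m → ℕ) (l : ℝ) (i : Fin m) (σ : LearnerState m) :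
    ENNReal :=
  ENNReal.ofReal
    (Real.exp (l * (σ.count i * (σ.mean i - 1 / d i)) - l ^ 2 / 8 * σ.count i))

/-- The product `count * (mean - 1 / d i)` is the sum of the centred observations, so a new
observation only contributes a factor. -/
theorem expDeviation_update (l : ℝ) (i : Fin m) (σ : LearnerState m)
    (S : (i : Fin m) → List (Fin (d i))) :
    expDeviation d l i (σ.update S) = expDeviation d l i σ *
      if 1 < (S i).length then
        ENNReal.ofReal (Real.exp (l * (collisionAverage (S i) - 1 / d i) - l ^ 2 / 8))
      else 1 := by
  unfold expDeviation LearnerState.update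
  split_ifs with h
  · rw [← ENNReal.ofReal_mul (Real.exp_pos _).le, ← Real.exp_add]
    congr 2
    have : (σ.count i : ℝ) + 1 ≠ 0 := by positivity
    simp only [h, if_true]
    push_cast
    field_simp
    ring
  · simp [h]

variable {Ω : Type*} {mΩ : MeasurableSpace Ω} {P : Measure Ω} {ℱ : Filtration ℕ mΩ}
  {Φ : ℕ → Ω → Realization K d} {k : ℕ → Ω → Fin m → ℕ}

/-- The memory of the learner at the end of round `t`, as a random variable. -/
noncomputable abbrev stateProcess (k : ℕ → Ω → Fin m → ℕ) (Φ : ℕ → Ω → Realization K d) (t : ℕ)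
    (ω : Ω) : LearnerState m :=
  stateAfter (fun s => k s ω) (fun s => Φ s ω) t

theorem IsRevisedCLCB.sum_eq (halg : IsRevisedCLCB ℱ Φ k) (t : ℕ) (ω : Ω) :
    ∑ i, k (t + 1) ω i = K :=
  (halg.greedy t ω).sum_eq

theorem IsRevisedCLCB.le_budget (halg : IsRevisedCLCB ℱ Φ k) (t : ℕ) (ω : Ω) (i : Fin m) :
    k (t + 1) ω i ≤ K :=
  (Finset.single_le_sum (fun _ _ => Nat.zero_le _) (Finset.mem_univ i)).trans_eq
    (halg.sum_eq t ω)

theorem measurable_stateProcess (henv : IsOnlineEnvironment d P ℱ Φ) (halg : IsRevisedCLCB ℱ Φ k)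
    (i : Fin m) (t : ℕ) :
    Measurable[ℱ t] (fun ω => (stateProcess k Φ t ω).count i) ∧
      Measurable[ℱ t] (fun ω => (stateProcess k Φ t ω).mean i) := by
  induction t with
  | zero => exact ⟨measurable_const, measurable_const⟩
  | succ t ih =>
    have hle := ℱ.mono (Nat.le_succ t)
    exact @measurable_update m K d Ω (ℱ (t + 1)) _ _ _ i
      ⟨ih.1.mono hle le_rfl, ih.2.mono hle le_rfl⟩
      ((halg.nonanticipating t).mono hle le_rfl) (henv.adapted t)

theorem measurable_expDeviation (henv : IsOnlineEnvironment d P ℱ Φ) (halg : IsRevisedCLCB ℱ Φ k)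
    (l : ℝ) (i : Fin m) (t : ℕ) :
    Measurable[ℱ t] fun ω => expDeviation d l i (stateProcess k Φ t ω) := by
  obtain ⟨hc, hm⟩ := measurable_stateProcess henv halg i t
  have hc' : Measurable[ℱ t] fun ω => ((stateProcess k Φ t ω).count i : ℝ) :=
    measurable_from_top.comp hc
  exact ENNReal.measurable_ofReal.comp (Real.measurable_exp.comp
    (((hc'.mul (hm.sub_const _)).const_mul l).sub (hc'.const_mul _)))

theorem count_stateProcess_le (i : Fin m) (t : ℕ) (ω : Ω) :
    (stateProcess k Φ t ω).count i ≤ t := by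
  induction t with
  | zero => exact le_rfl
  | succ t ih =>
    refine Nat.add_le_add ih ?_
    split_ifs <;> simp

/-- Without data the lower bound is therefore `0`, which is optimistic although the radius is `0`
too. -/
theorem mean_stateProcess_of_count_eq_zero (i : Fin m) (t : ℕ) (ω : Ω)
    (h : (stateProcess k Φ t ω).count i = 0) : (stateProcess k Φ t ω).mean i = 0 := by
  induction t with
  | zero => rfl
  | succ t ih =>
    obtain ⟨h1, h2⟩ := Nat.add_eq_zero_iff.1 h
    have h3 : ¬ 1 < (feedback (k (t + 1) ω) (Φ (t + 1) ω) i).length := by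
      intro h3
      rw [if_pos h3] at h2
      exact one_ne_zero h2
    exact (if_neg h3).trans (ih h1)

variable [∀ i, NeZero (d i)]

/-- A supermartingale argument: whether community `i` is observed in the next round is decided by
the past, and given the past the new factor has mean at most `1`. -/
theorem lintegral_expDeviation_le [IsProbabilityMeasure P] (henv : IsOnlineEnvironment d P ℱ Φ)
    (halg : IsRevisedCLCB ℱ Φ k) (l : ℝ) (i : Fin m) (t : ℕ) :
    ∫⁻ ω, expDeviation d l i (stateProcess k Φ t ω) ∂P ≤ 1 := by
  induction t with
  | zero => simp [stateProcess, stateAfter, expDeviation, LearnerState.init]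
  | succ t ih =>
    refine le_trans ?_ ih
    let g : (Fin m → ℕ) → Realization K d → ENNReal := fun a φ =>
      if 1 < (feedback a φ i).length then
        ENNReal.ofReal (Real.exp (l * (collisionAverage (feedback a φ i) - 1 / d i) - l ^ 2 / 8))
      else 1
    have hstep : ∀ ω, expDeviation d l i (stateProcess k Φ (t + 1) ω) =
        expDeviation d l i (stateProcess k Φ t ω) * g (k (t + 1) ω) (Φ (t + 1) ω) :=
      fun ω => expDeviation_update _ _ _ _
    rw [lintegral_congr hstep]
    refine (lintegral_mul_comp_of_indep (ℱ.le t) (halg.nonanticipating t)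
      ((henv.adapted t).mono (ℱ.le (t + 1)) le_rfl) (henv.indep t)
      (measurable_expDeviation henv halg l i t) (g := g) fun _ => Measurable.of_discrete).trans_le ?_
    rw [henv.law t]
    refine lintegral_mono fun ω => mul_le_of_le_one_right' ?_
    have hK := halg.le_budget t ω i
    simp only [g, length_feedback hK]
    split_ifs with h
    · exact lintegral_exp_feedback_le hK h l
    · simp

theorem measureReal_exp_le_expDeviation [IsProbabilityMeasure P]
    (henv : IsOnlineEnvironment d P ℱ Φ) (halg : IsRevisedCLCB ℱ Φ k) (l c : ℝ) (i : Fin m)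
    (t : ℕ) :
    P.real {ω | c ≤ l * ((stateProcess k Φ t ω).count i * ((stateProcess k Φ t ω).mean i - 1 / d i))
      - l ^ 2 / 8 * (stateProcess k Φ t ω).count i} ≤ Real.exp (-c) := by
  have hm := mul_meas_ge_le_lintegral (μ := P)
    ((measurable_expDeviation henv halg l i t).mono (ℱ.le t) le_rfl) (ENNReal.ofReal (Real.exp c))
  have h1 := hm.trans (lintegral_expDeviation_le henv halg l i t)
  have hset : {ω | ENNReal.ofReal (Real.exp c) ≤ expDeviation d l i (stateProcess k Φ t ω)} =
      {ω | c ≤ l * ((stateProcess k Φ t ω).count i * ((stateProcess k Φ t ω).mean i - 1 / d i))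
        - l ^ 2 / 8 * (stateProcess k Φ t ω).count i} := by
    ext ω
    simp only [Set.mem_ofPred_eq, expDeviation]
    rw [ENNReal.ofReal_le_ofReal_iff (Real.exp_pos _).le, Real.exp_le_exp]
  rw [hset] at h1
  have h2 := ENNReal.toReal_mono ENNReal.one_ne_top h1
  rw [ENNReal.toReal_mul, ENNReal.toReal_ofReal (Real.exp_pos _).le, ENNReal.toReal_one] at h2
  rw [Real.exp_neg, measureReal_def, ← one_div, le_div_iff₀ (Real.exp_pos _), mul_comm]
  exact h2

/-- The empirical means are within the confidence radii used in round `t`. -/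
def IsAccurate (d : Fin m → ℕ) (σ : LearnerState m) (t : ℕ) : Prop :=
  ∀ i, 0 < σ.count i → |σ.mean i - 1 / d i| ≤ σ.radius t i

/-- Fixing the sample size `s` makes the radius a constant `ρ`, so the exponential parameter can be
tuned to it. -/
theorem measureReal_count_eq_and_radius_lt_le [IsProbabilityMeasure P]
    (henv : IsOnlineEnvironment d P ℱ Φ) (halg : IsRevisedCLCB ℱ Φ k) (i : Fin m) (t : ℕ) {s : ℕ}
    (hs : 0 < s) :
    P.real {ω | (stateProcess k Φ t ω).count i = s ∧
      (stateProcess k Φ t ω).radius (t + 1) i < |(stateProcess k Φ t ω).mean i - 1 / d i|} ≤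
      2 / ((t + 1 : ℕ) : ℝ) ^ 3 := by
  have hs' : (0 : ℝ) < s := Nat.cast_pos.2 hs
  set ρ := √(3 * Real.log ((t + 1 : ℕ) : ℝ) / (2 * s)) with hρ
  have hlog : 0 ≤ Real.log ((t + 1 : ℕ) : ℝ) := Real.log_natCast_nonneg _
  have hρ0 : 0 ≤ ρ := Real.sqrt_nonneg _
  have hρ2 : 2 * ρ ^ 2 * s = 3 * Real.log ((t + 1 : ℕ) : ℝ) := by
    rw [hρ, Real.sq_sqrt (by positivity)]
    field_simp
  have hexp : Real.exp (-(3 * Real.log ((t + 1 : ℕ) : ℝ))) = 1 / ((t + 1 : ℕ) : ℝ) ^ 3 := by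
    rw [Real.exp_neg, ← one_div, mul_comm, Real.exp_mul, Real.exp_log (by positivity)]
    norm_cast
  -- The value `l = 4 * ρ` maximizes `l * ρ * s - l ^ 2 / 8 * s`; the maximum `2 * ρ ^ 2 * s` equals
  -- `3 * log (t + 1)`. The opposite sign handles the lower tail.
  have h1 := measureReal_exp_le_expDeviation henv halg (4 * ρ)
    (3 * Real.log ((t + 1 : ℕ) : ℝ)) i t
  have h2 := measureReal_exp_le_expDeviation henv halg (-(4 * ρ))
    (3 * Real.log ((t + 1 : ℕ) : ℝ)) i t
  rw [hexp] at h1 h2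
  refine (measureReal_mono (fun ω hω => ?_)).trans
    ((measureReal_union_le _ _).trans ((add_le_add h1 h2).trans (le_of_eq (by ring))))
  obtain ⟨hc, hr⟩ := hω
  have hrad : (stateProcess k Φ t ω).radius (t + 1) i = ρ := by
    unfold LearnerState.radius
    rw [if_neg (by omega), hc, hρ]
  rw [hrad] at hr
  rcases lt_abs.1 hr with h | h
  · left
    simp only [Set.mem_ofPred_eq, hc]
    nlinarith [mul_le_mul_of_nonneg_left h.le (mul_nonneg hρ0 hs'.le)]
  · right
    simp only [Set.mem_ofPred_eq, hc]
    nlinarith [mul_le_mul_of_nonneg_left h.le (mul_nonneg hρ0 hs'.le)]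

/-- A union bound over the communities and the sample sizes `1, …, t`; the latter costs one of the
three powers of `t + 1`. -/
theorem measureReal_not_isAccurate_le [IsProbabilityMeasure P]
    (henv : IsOnlineEnvironment d P ℱ Φ) (halg : IsRevisedCLCB ℱ Φ k) (t : ℕ) :
    P.real {ω | ¬ IsAccurate d (stateProcess k Φ t ω) (t + 1)} ≤
      2 * m * (1 / ((t + 1 : ℕ) : ℝ) ^ 2) := by
  have hsub : {ω | ¬ IsAccurate d (stateProcess k Φ t ω) (t + 1)} ⊆
      ⋃ i ∈ (Finset.univ : Finset (Fin m)), ⋃ s ∈ Finset.range t,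
        {ω | (stateProcess k Φ t ω).count i = s + 1 ∧ (stateProcess k Φ t ω).radius (t + 1) i <
          |(stateProcess k Φ t ω).mean i - 1 / d i|} := by
    intro ω hω
    simp only [Set.mem_ofPred_eq, IsAccurate, not_forall, not_le] at hω
    obtain ⟨i, hc, hr⟩ := hω
    have hle := count_stateProcess_le (k := k) (Φ := Φ) i t ω
    simp only [Set.mem_iUnion]
    refine ⟨i, Finset.mem_univ i, (stateProcess k Φ t ω).count i - 1,
      Finset.mem_range.2 (by omega), by omega, hr⟩
  refine (measureReal_mono hsub (measure_ne_top _ _)).trans ((measureReal_biUnion_finset_le _ _).trans ?_)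
  calc _ ≤ ∑ _i : Fin m, ∑ _s ∈ Finset.range t, 2 / ((t + 1 : ℕ) : ℝ) ^ 3 :=
        Finset.sum_le_sum fun i _ => (measureReal_biUnion_finset_le _ _).trans
          (Finset.sum_le_sum fun s _ =>
            measureReal_count_eq_and_radius_lt_le henv halg i t (Nat.succ_pos s))
    _ = 2 * m * (t / ((t + 1 : ℕ) : ℝ) ^ 3) := by simp; ring
    _ ≤ _ := by
      refine mul_le_mul_of_nonneg_left ?_ (by positivity)
      rw [div_le_div_iff₀ (by positivity) (by positivity)]
      push_cast
      have : (0 : ℝ) ≤ t := Nat.cast_nonneg t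
      nlinarith [sq_nonneg ((t : ℝ) + 1)]

end State

/-! ### From confidence widths to charges per community. -/

section Charge

/-- The regret charged to a community with gap `M` in a round that it enters with a given number of
observations. -/
noncomputable def charge (B L M : ℝ) : ℕ → ℝ
  | 0 => 2 * B
  | s + 1 => max 0 (2 * B * √(6 * L) / √((s + 1 : ℕ) : ℝ) - M)

theorem charge_nonneg {B : ℝ} (hB : 0 ≤ B) (L M : ℝ) (s : ℕ) : 0 ≤ charge B L M s := by
  cases s with
  | zero => simpa [charge] using hB
  | succ s => exact le_max_left _ _

theorem sum_charge_le {B L M : ℝ} (hB : 0 ≤ B) (hL : 0 ≤ L) (hM : 0 < M) (N : ℕ) :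
    ∑ s ∈ Finset.range N, charge B L M s ≤ 48 * B ^ 2 * L / M + 2 * B := by
  have h0 : 0 ≤ 48 * B ^ 2 * L / M := by positivity
  cases N with
  | zero => simp; positivity
  | succ N =>
    rw [Finset.sum_range_succ']
    refine add_le_add ?_ le_rfl
    refine (sum_max_div_sqrt_sub_le (by positivity) hM N).trans ?_
    refine div_le_div_of_nonneg_right ?_ hM.le
    -- The square is `24 * B ^ 2 * L`, half of what is allowed.
    rw [mul_pow, Real.sq_sqrt (by positivity)]
    nlinarith [mul_nonneg (sq_nonneg B) hL]

variable {m K : ℕ} {d : Fin m → ℕ}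

theorem IsAccurate.lcb_le {σ : LearnerState m} {t : ℕ} (h : IsAccurate d σ t)
    (h0 : ∀ i, σ.count i = 0 → σ.mean i = 0) (i : Fin m) : σ.lcb t i ≤ 1 / d i := by
  refine max_le (by positivity) ?_
  rcases Nat.eq_zero_or_pos (σ.count i) with hc | hc
  · rw [h0 i hc, LearnerState.radius, if_pos hc, sub_zero]
    positivity
  · linarith [(abs_le.1 (h i hc)).2]

theorem IsAccurate.sub_lcb_le {σ : LearnerState m} {t : ℕ} (h : IsAccurate d σ t) {i : Fin m}
    (hc : 0 < σ.count i) : 1 / d i - σ.lcb t i ≤ 2 * σ.radius t i := by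
  have h1 : σ.mean i - σ.radius t i ≤ σ.lcb t i := le_max_right _ _
  linarith [(abs_le.1 (h i hc)).1]

variable [∀ i, NeZero (d i)]

theorem one_div_size_le_one (i : Fin m) : 1 / (d i : ℝ) ≤ 1 :=
  div_le_one_of_le₀ (Nat.one_le_cast.2 (NeZero.one_le)) (Nat.cast_nonneg _)

/-- The gap of a greedy allocation is controlled by the widths of the confidence bounds. -/
theorem gap_le_sum_choose_two {μ : Fin m → ℝ} {k kstar : Fin m → ℕ} (hμ0 : ∀ i, 0 ≤ μ i)
    (hμ : ∀ i, μ i ≤ 1 / d i) (hk : GreedyAllocation μ K k) (hs : ∑ i, kstar i ≤ K) :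
    gap K d kstar k ≤ ∑ i, ((k i).choose 2 : ℕ) * (1 / (d i : ℝ) - μ i) := by
  have hle : ∀ {a : Fin m → ℕ}, ∑ i, a i ≤ K → ∀ i, a i ≤ K := fun ha i =>
    (Finset.single_le_sum (fun _ _ => Nat.zero_le _) (Finset.mem_univ i)).trans ha
  have h1 := hk.sum_geom_le hμ0 (fun i => (hμ i).trans (one_div_size_le_one i)) hs
  -- Optimism: smaller collision probabilities raise the value of `kstar`, and `k` is optimal for
  -- them by `h1`.
  have h2 : expectedReward K d kstar ≤ ∑ i, ∑ j ∈ Finset.range (kstar i), (1 - μ i) ^ j := by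
    rw [expectedReward_eq (hle hs)]
    exact Finset.sum_le_sum fun i _ => sum_geom_antitone (hμ i) (one_div_size_le_one i) _
  have h3 := Finset.sum_le_sum fun (i : Fin m) (_ : i ∈ Finset.univ) =>
    sum_geom_sub_le (hμ0 i) (hμ i) (one_div_size_le_one i) (k i)
  rw [Finset.sum_sub_distrib] at h3
  rw [gap, expectedReward_eq (hle hk.sum_eq.le)]
  linarith

theorem gap_le_sum_charge {σ : LearnerState m} {t T : ℕ} (ht : t ≤ T) (ht0 : 0 < t) (hmK : m < K)
    (hacc : IsAccurate d σ t) (h0 : ∀ i, σ.count i = 0 → σ.mean i = 0) {k kstar : Fin m → ℕ}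
    (hk : GreedyAllocation (σ.lcb t) K k) (hk1 : ∀ i, 1 ≤ k i) (hs : ∑ i, kstar i ≤ K)
    {M : Fin m → ℝ} (hgap : 0 < gap K d kstar k) (hM : ∀ i, 1 < k i → M i ≤ gap K d kstar k) :
    gap K d kstar k ≤ ∑ i, if 1 < k i then
      charge (((K - m + 1).choose 2 : ℕ) : ℝ) (Real.log T) (M i) (σ.count i) else 0 := by
  set B : ℝ := (((K - m + 1).choose 2 : ℕ) : ℝ) with hB
  set g := gap K d kstar k with hg
  have hB0 : 0 < B := Nat.cast_pos.2 (Nat.choose_pos (by omega))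
  have hlcb0 : ∀ i, 0 ≤ σ.lcb t i := fun i => le_max_left _ _
  have h1 : g ≤ ∑ i, ((k i).choose 2 : ℕ) * (1 / (d i : ℝ) - σ.lcb t i) :=
    gap_le_sum_choose_two hlcb0 (hacc.lcb_le h0) hk hs
  have hsumN := sum_choose_two_le hk.sum_eq hk1
  have hsum : ∑ i, (((k i).choose 2 : ℕ) : ℝ) ≤ B := by rw [hB]; exact_mod_cast hsumN
  have hc : ∀ i, (((k i).choose 2 : ℕ) : ℝ) ≤ B := fun i =>
    (Finset.single_le_sum (f := fun i => (((k i).choose 2 : ℕ) : ℝ))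
      (fun _ _ => Nat.cast_nonneg _) (Finset.mem_univ i)).trans hsum
  -- Here `g` is bounded by `2 * g - g`, with `h1` used for `2 * g`; since the weights sum to at
  -- most `B`, the subtracted terms total at most `g`.
  have h2 : g ≤ ∑ i, (((k i).choose 2 : ℕ) : ℝ) * (2 * (1 / (d i : ℝ) - σ.lcb t i) - g / B) := by
    have h3 : (∑ i, (((k i).choose 2 : ℕ) : ℝ)) * (g / B) ≤ g := by
      calc _ ≤ B * (g / B) := mul_le_mul_of_nonneg_right hsum (by positivity)
        _ = g := by field_simp
    have h4 : ∑ i, (((k i).choose 2 : ℕ) : ℝ) * (2 * (1 / (d i : ℝ) - σ.lcb t i) - g / B) =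
        2 * ∑ i, ((k i).choose 2 : ℕ) * (1 / (d i : ℝ) - σ.lcb t i) -
          (∑ i, (((k i).choose 2 : ℕ) : ℝ)) * (g / B) := by
      rw [Finset.mul_sum, Finset.sum_mul, ← Finset.sum_sub_distrib]
      exact Finset.sum_congr rfl fun i _ => by ring
    linarith
  refine h2.trans (Finset.sum_le_sum fun i _ => ?_)
  have hgB : 0 < g / B := by positivity
  split_ifs with hi
  · have hci0 : (0 : ℝ) ≤ ((k i).choose 2 : ℕ) := Nat.cast_nonneg _
    rcases hs0 : σ.count i with _ | s
    -- Before any observation only the trivial width `1` is available, hence the charge `2 * B`.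
    · have hx : 1 / (d i : ℝ) - σ.lcb t i ≤ 1 := by
        linarith [hlcb0 i, one_div_size_le_one (d := d) i]
      have : 2 * (1 / (d i : ℝ) - σ.lcb t i) - g / B ≤ 2 := by linarith
      calc _ ≤ (((k i).choose 2 : ℕ) : ℝ) * 2 := mul_le_mul_of_nonneg_left this hci0
        _ ≤ B * 2 := mul_le_mul_of_nonneg_right (hc i) zero_le_two
        _ = charge B (Real.log T) (M i) 0 := mul_comm _ _
    · have hx := hacc.sub_lcb_le (i := i) (by omega)
      have hlog : Real.log t ≤ Real.log T :=
        Real.log_le_log (Nat.cast_pos.2 ht0) (Nat.cast_le.2 ht)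
      have hs1 : (0 : ℝ) < ((s + 1 : ℕ) : ℝ) := by positivity
      -- Squaring gives `4 * (3 * log t / (2 * (s + 1)))`, that is `6 * log t / (s + 1)`.
      have hrad : 2 * σ.radius t i ≤ √(6 * Real.log T) / √((s + 1 : ℕ) : ℝ) := by
        rw [LearnerState.radius, if_neg (by omega), hs0, ← Real.sqrt_div' _ hs1.le]
        have : (2 : ℝ) = √4 := by
          rw [show (4 : ℝ) = 2 ^ 2 by norm_num, Real.sqrt_sq zero_le_two]
        rw [this, ← Real.sqrt_mul (by norm_num)]
        refine Real.sqrt_le_sqrt ?_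
        rw [← this, mul_div_assoc', div_le_div_iff₀ (by positivity) hs1]
        nlinarith
      rw [charge]
      rcases le_total (2 * (1 / (d i : ℝ) - σ.lcb t i) - g / B) 0 with hn | hp
      · exact (mul_nonpos_of_nonneg_of_nonpos hci0 hn).trans (le_max_left _ _)
      · refine le_trans ?_ (le_max_right _ _)
        calc _ ≤ B * (2 * (1 / (d i : ℝ) - σ.lcb t i) - g / B) :=
              mul_le_mul_of_nonneg_right (hc i) hp
          _ = 2 * B * (1 / (d i : ℝ) - σ.lcb t i) - g := by field_simp
          _ ≤ 2 * B * (√(6 * Real.log T) / √((s + 1 : ℕ) : ℝ)) - M i :=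
              sub_le_sub (mul_le_mul_of_nonneg_left (hx.trans hrad) (by positivity)) (hM i hi)
          _ = _ := by rw [mul_div_assoc]
  · rw [Nat.choose_eq_zero_of_lt (by omega)]
    simp

end Charge

/-! ### Extremal gaps of the bad actions. -/

section Gaps

variable {m K : ℕ} {d : Fin m → ℕ} {kstar : Fin m → ℕ} {i : Fin m}

theorem finite_badActions : (badActions K d kstar i).Finite := by
  refine (Set.finite_Iic fun _ => K).subset fun k hk j => ?_
  exact (Finset.single_le_sum (fun _ _ => Nat.zero_le _) (Finset.mem_univ j)).trans_eq hk.1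

theorem gapMin_of_empty (h : badActions K d kstar i = ∅) : gapMin K d kstar i = ⊤ := by
  simp [gapMin, h]

theorem exists_gapMin_eq_coe (h : (badActions K d kstar i).Nonempty) :
    ∃ M : ℝ, 0 < M ∧ gapMin K d kstar i = M ∧
      ∀ k ∈ badActions K d kstar i, M ≤ gap K d kstar k := by
  obtain ⟨k, hk, hmin⟩ := Set.exists_min_image _ (gap K d kstar) finite_badActions h
  refine ⟨gap K d kstar k, hk.2.1, le_antisymm (iInf₂_le k hk) ?_, hmin⟩
  exact le_iInf₂ fun a ha => EReal.coe_le_coe_iff.2 (hmin a ha)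

theorem gapMaxAt_nonneg : 0 ≤ gapMaxAt K d kstar i := by
  refine Real.sSup_nonneg ?_
  rintro _ ⟨k, hk, rfl⟩
  exact hk.2.1.le

theorem gapMax_nonneg : 0 ≤ gapMax K d kstar :=
  Real.iSup_nonneg fun _ => gapMaxAt_nonneg

theorem gap_le_gapMax {k : Fin m → ℕ} (hk : k ∈ badActions K d kstar i) :
    gap K d kstar k ≤ gapMax K d kstar :=
  (le_csSup (finite_badActions.image _).bddAbove (Set.mem_image_of_mem _ hk)).trans
    (le_ciSup (f := gapMaxAt K d kstar) (Set.finite_range _).bddAbove i)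

/-- Pigeonhole; it places every suboptimal action among the bad actions of some community, so that
`gapMax` bounds its gap. -/
theorem exists_one_lt {k : Fin m → ℕ} (hmK : m < K) (hk : ∑ j, k j = K) : ∃ i, 1 < k i := by
  by_contra! h
  have := Finset.sum_le_sum fun (j : Fin m) (_ : j ∈ Finset.univ) => h j
  simp at this
  omega

end Gaps

/-! ### The regret as a sum of gaps, and its bound. -/

section Regret

variable {m K : ℕ} {d : Fin m → ℕ} {Ω : Type*} {mΩ : MeasurableSpace Ω} {P : Measure Ω}
  {ℱ : Filtration ℕ mΩ} {Φ : ℕ → Ω → Realization K d} {k : ℕ → Ω → Fin m → ℕ}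
  {kstar : Fin m → ℕ}

theorem count_stateProcess_succ (halg : IsRevisedCLCB ℱ Φ k) (i : Fin m) (t : ℕ) (ω : Ω) :
    (stateProcess k Φ (t + 1) ω).count i =
      (stateProcess k Φ t ω).count i + if 1 < k (t + 1) ω i then 1 else 0 := by
  rw [← length_feedback (halg.le_budget t ω i) (Φ (t + 1) ω)]
  rfl

/-- The rounds that give an observation of community `i` have the numbers of observations
`0, 1, 2, …`. -/
theorem sum_comp_count (halg : IsRevisedCLCB ℱ Φ k) (f : ℕ → ℝ) (i : Fin m) (T : ℕ) (ω : Ω) :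
    ∑ t ∈ Finset.range T,
      (if 1 < k (t + 1) ω i then f ((stateProcess k Φ t ω).count i) else 0) =
      ∑ s ∈ Finset.range ((stateProcess k Φ T ω).count i), f s := by
  induction T with
  | zero => rfl
  | succ T ih =>
    rw [Finset.sum_range_succ, ih, count_stateProcess_succ halg]
    split_ifs
    · rw [Finset.sum_range_succ]
    · rw [add_zero, add_zero]

theorem reward_le (a : Fin m → ℕ) (φ : Realization K d) : reward a φ ≤ ∑ i, d i :=
  Finset.sum_le_sum fun _ _ => (Finset.card_le_univ _).trans_eq (Fintype.card_fin _)

theorem gap_nonneg (hopt : IsOptimalAllocation K d kstar) {a : Fin m → ℕ} (ha : ∑ i, a i ≤ K) :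
    0 ≤ gap K d kstar a :=
  sub_nonneg.2 (hopt.2 a ha)

theorem measurableSet_isAccurate (henv : IsOnlineEnvironment d P ℱ Φ)
    (halg : IsRevisedCLCB ℱ Φ k) (t : ℕ) :
    MeasurableSet {ω | IsAccurate d (stateProcess k Φ t ω) (t + 1)} := by
  simp only [IsAccurate, Set.ofPred_forall]
  refine MeasurableSet.iInter fun i => ?_
  obtain ⟨hc, hm⟩ := measurable_stateProcess henv halg i t
  replace hc := hc.mono (ℱ.le t) le_rfl
  replace hm := hm.mono (ℱ.le t) le_rfl
  have hr : Measurable fun ω => (stateProcess k Φ t ω).radius (t + 1) i :=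
    (Measurable.of_discrete (f := fun s : ℕ =>
      if s = 0 then 0 else √(3 * Real.log ((t + 1 : ℕ) : ℝ) / (2 * s)))).comp hc
  have h1 : MeasurableSet {ω | |(stateProcess k Φ t ω).mean i - 1 / d i| ≤
      (stateProcess k Φ t ω).radius (t + 1) i} :=
    measurableSet_le (continuous_abs.measurable.comp (hm.sub_const _)) hr
  have h2 : MeasurableSet {ω | 0 < (stateProcess k Φ t ω).count i} :=
    measurableSet_lt measurable_const hc
  have : {ω | 0 < (stateProcess k Φ t ω).count i →
      |(stateProcess k Φ t ω).mean i - 1 / d i| ≤ (stateProcess k Φ t ω).radius (t + 1) i} =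
      {ω | 0 < (stateProcess k Φ t ω).count i}ᶜ ∪
        {ω | |(stateProcess k Φ t ω).mean i - 1 / d i| ≤
          (stateProcess k Φ t ω).radius (t + 1) i} := by
    ext ω
    exact imp_iff_not_or
  rw [this]
  exact h2.compl.union h1

theorem expectedReward_nonneg (a : Fin m → ℕ) : 0 ≤ expectedReward K d a :=
  integral_nonneg fun _ => Nat.cast_nonneg _

variable [IsProbabilityMeasure P]

theorem integrable_reward {κ : Ω → Fin m → ℕ} (hκ : Measurable κ) {φ : Ω → Realization K d}
    (hφ : Measurable φ) : Integrable (fun ω => (reward (κ ω) (φ ω) : ℝ)) P := by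
  refine Integrable.of_bound ((Measurable.of_discrete
    (f := fun p : (Fin m → ℕ) × Realization K d => (reward p.1 p.2 : ℝ))).comp
      (hκ.prodMk hφ)).aestronglyMeasurable ((∑ i, d i : ℕ) : ℝ) (ae_of_all _ fun ω => ?_)
  rw [Real.norm_of_nonneg (Nat.cast_nonneg _)]
  exact Nat.cast_le.2 (reward_le _ _)

variable [∀ i, NeZero (d i)]

theorem expectedReward_le (a : Fin m → ℕ) : expectedReward K d a ≤ ((∑ i, d i : ℕ) : ℝ) := by
  refine (integral_mono (g := fun _ => ((∑ i, d i : ℕ) : ℝ)) Integrable.of_finite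
    (integrable_const _) fun φ => Nat.cast_le.2 (reward_le a φ)).trans_eq ?_
  simp

theorem integrable_expectedReward {κ : Ω → Fin m → ℕ} (hκ : Measurable κ) :
    Integrable (fun ω => expectedReward K d (κ ω)) P := by
  refine Integrable.of_bound ((Measurable.of_discrete (f := expectedReward K d)).comp
    hκ).aestronglyMeasurable ((∑ i, d i : ℕ) : ℝ) (ae_of_all _ fun ω => ?_)
  rw [Real.norm_of_nonneg (expectedReward_nonneg _)]
  exact expectedReward_le _

/-- An allocation fixed by the past is independent of the new realization, which can be integrated
out first. -/
theorem integral_reward_eq (henv : IsOnlineEnvironment d P ℱ Φ) (t : ℕ) {κ : Ω → Fin m → ℕ}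
    (hκ : Measurable[ℱ t] κ) :
    ∫ ω, (reward (κ ω) (Φ (t + 1) ω) : ℝ) ∂P = ∫ ω, expectedReward K d (κ ω) ∂P := by
  have hΦ : Measurable (Φ (t + 1)) := (henv.adapted t).mono (ℱ.le _) le_rfl
  have hκ' : Measurable κ := hκ.mono (ℱ.le t) le_rfl
  rw [integral_eq_lintegral_of_nonneg_ae (ae_of_all _ fun _ => Nat.cast_nonneg _)
      (integrable_reward hκ' hΦ).aestronglyMeasurable,
    integral_eq_lintegral_of_nonneg_ae (ae_of_all _ fun _ => expectedReward_nonneg _)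
      (integrable_expectedReward hκ').aestronglyMeasurable]
  congr 1
  have h := lintegral_mul_comp_of_indep (ℱ.le t) hκ hΦ (henv.indep t) (W := fun _ => 1)
    measurable_const (g := fun a φ => ENNReal.ofReal (reward a φ : ℝ))
    fun _ => Measurable.of_discrete
  simp only [one_mul, henv.law t] at h
  rw [h]
  refine lintegral_congr fun ω => ?_
  exact (ofReal_integral_eq_lintegral_ofReal Integrable.of_finite
    (ae_of_all _ fun _ => Nat.cast_nonneg _)).symm

theorem integrable_gap (halg : IsRevisedCLCB ℱ Φ k) (t : ℕ) :
    Integrable (fun ω => gap K d kstar (k (t + 1) ω)) P :=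
  (integrable_const _).sub
    (integrable_expectedReward ((halg.nonanticipating t).mono (ℱ.le t) le_rfl))

theorem regret_eq (henv : IsOnlineEnvironment d P ℱ Φ) (halg : IsRevisedCLCB ℱ Φ k) (T : ℕ) :
    regret P Φ kstar k T = ∫ ω, ∑ t ∈ Finset.range T, gap K d kstar (k (t + 1) ω) ∂P := by
  have hΦ : ∀ t, Measurable (Φ (t + 1)) := fun t => (henv.adapted t).mono (ℱ.le _) le_rfl
  have hk : ∀ t, Measurable (k (t + 1)) := fun t => (halg.nonanticipating t).mono (ℱ.le t) le_rfl
  have hreindex : ∀ f : ℕ → ℝ, ∑ t ∈ Finset.Icc 1 T, f t = ∑ t ∈ Finset.range T, f (t + 1) := by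
    intro f
    rw [Finset.range_eq_Ico, Finset.sum_Ico_add' f 0 T 1]
    rfl
  have hint : ∀ t, Integrable (fun ω => (reward kstar (Φ (t + 1) ω) : ℝ) -
      reward (k (t + 1) ω) (Φ (t + 1) ω)) P := fun t =>
    (integrable_reward measurable_const (hΦ t)).sub (integrable_reward (hk t) (hΦ t))
  simp only [regret, hreindex]
  rw [integral_finsetSum _ fun t _ => hint t,
    integral_finsetSum _ fun t _ => integrable_gap halg t]
  refine Finset.sum_congr rfl fun t _ => ?_
  rw [integral_sub (integrable_reward measurable_const (hΦ t))
      (integrable_reward (hk t) (hΦ t)),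
    integral_reward_eq henv t measurable_const, integral_reward_eq henv t (halg.nonanticipating t),
    ← integral_sub (integrable_const _) (integrable_expectedReward (hk t))]
  rfl

/-- A bound on the sum of the gaps that holds on every sample path. -/
theorem sum_gap_le (hmK : m < K) (halg : IsRevisedCLCB ℱ Φ k)
    (hopt : IsOptimalAllocation K d kstar) (T : ℕ) {M D : Fin m → ℝ}
    (hM : ∀ i, ∀ a ∈ badActions K d kstar i, M i ≤ gap K d kstar a)
    (hD0 : ∀ i, 0 ≤ D i) (hD : ∀ i, (badActions K d kstar i).Nonempty → ∀ N,
      ∑ s ∈ Finset.range N,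
        charge (((K - m + 1).choose 2 : ℕ) : ℝ) (Real.log T) (M i) s ≤ D i) (ω : Ω) :
    ∑ t ∈ Finset.range T, gap K d kstar (k (t + 1) ω) ≤ ∑ i, D i +
      ∑ t ∈ Finset.range T,
        {ω | ¬ IsAccurate d (stateProcess k Φ t ω) (t + 1)}.indicator
          (fun _ => gapMax K d kstar) ω := by
  classical
  set B : ℝ := (((K - m + 1).choose 2 : ℕ) : ℝ) with hB
  have hB0 : 0 ≤ B := Nat.cast_nonneg _
  let c : ℕ → Fin m → ℝ := fun t i =>
    if 1 < k (t + 1) ω i then charge B (Real.log T) (M i) ((stateProcess k Φ t ω).count i) else 0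
  have hc0 : ∀ t i, 0 ≤ c t i := by
    intro t i
    simp only [c]
    split_ifs
    exacts [charge_nonneg hB0 _ _ _, le_rfl]
  -- Only communities with a bad action are charged, since `hD` controls no others.
  have hround : ∀ t ∈ Finset.range T, gap K d kstar (k (t + 1) ω) ≤
      ∑ i, (if (badActions K d kstar i).Nonempty then c t i else 0) +
        {ω | ¬ IsAccurate d (stateProcess k Φ t ω) (t + 1)}.indicator
          (fun _ => gapMax K d kstar) ω := by
    intro t ht
    have hsum0 : 0 ≤ ∑ i, (if (badActions K d kstar i).Nonempty then c t i else 0) :=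
      Finset.sum_nonneg fun i _ => by split_ifs; exacts [hc0 t i, le_rfl]
    have hind0 : 0 ≤ {ω | ¬ IsAccurate d (stateProcess k Φ t ω) (t + 1)}.indicator
        (fun _ => gapMax K d kstar) ω := Set.indicator_nonneg (fun _ _ => gapMax_nonneg) _
    rcases (gap_nonneg hopt (halg.sum_eq t ω).le).eq_or_lt with hg | hg
    · rw [← hg]
      exact add_nonneg hsum0 hind0
    by_cases hacc : IsAccurate d (stateProcess k Φ t ω) (t + 1)
    · refine le_trans ?_ (le_add_of_nonneg_right hind0)
      have hbad : ∀ i, 1 < k (t + 1) ω i → k (t + 1) ω ∈ badActions K d kstar i := fun i hi =>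
        ⟨halg.sum_eq t ω, hg, hi⟩
      refine (gap_le_sum_charge (T := T) (Finset.mem_range.1 ht) (Nat.succ_pos t) hmK hacc
        (fun i => mean_stateProcess_of_count_eq_zero i t ω) (halg.greedy t ω) (halg.explores t ω)
        hopt.1 hg fun i hi => hM i _ (hbad i hi)).trans
          (Finset.sum_le_sum fun i _ => ?_)
      by_cases hi : 1 < k (t + 1) ω i
      · exact (if_pos (⟨_, hbad i hi⟩ : (badActions K d kstar i).Nonempty)).ge
      · rw [if_neg hi]
        split_ifs
        exacts [hc0 t i, le_rfl]
    · obtain ⟨i, hi⟩ := exists_one_lt hmK (halg.sum_eq t ω)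
      refine le_trans ?_ (le_add_of_nonneg_left hsum0)
      rw [Set.indicator_of_mem (by exact hacc)]
      exact gap_le_gapMax (i := i) ⟨halg.sum_eq t ω, hg, hi⟩
  refine (Finset.sum_le_sum hround).trans ?_
  -- After the exchange of sums, the charges of one community run along its successive numbers of
  -- observations.
  rw [Finset.sum_add_distrib, Finset.sum_comm]
  refine add_le_add (Finset.sum_le_sum fun i _ => ?_) le_rfl
  by_cases hne : (badActions K d kstar i).Nonempty
  · simp only [if_pos hne, c]
    rw [sum_comp_count halg]
    exact hD i hne _
  · simp only [if_neg hne, Finset.sum_const_zero]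
    exact hD0 i

theorem regret_le (hmK : m < K) (henv : IsOnlineEnvironment d P ℱ Φ) (halg : IsRevisedCLCB ℱ Φ k)
    (hopt : IsOptimalAllocation K d kstar) (T : ℕ) {M D : Fin m → ℝ}
    (hM : ∀ i, ∀ a ∈ badActions K d kstar i, M i ≤ gap K d kstar a)
    (hD0 : ∀ i, 0 ≤ D i) (hD : ∀ i, (badActions K d kstar i).Nonempty → ∀ N,
      ∑ s ∈ Finset.range N,
        charge (((K - m + 1).choose 2 : ℕ) : ℝ) (Real.log T) (M i) s ≤ D i) :
    regret P Φ kstar k T ≤ ∑ i, D i + Real.pi ^ 2 / 3 * m * gapMax K d kstar := by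
  have hmeas : ∀ t, MeasurableSet {ω | ¬ IsAccurate d (stateProcess k Φ t ω) (t + 1)} :=
    fun t => (measurableSet_isAccurate henv halg t).compl
  have hint : ∀ t, Integrable ({ω | ¬ IsAccurate d (stateProcess k Φ t ω) (t + 1)}.indicator
      fun _ => gapMax K d kstar) P := fun t => (integrable_const _).indicator (hmeas t)
  rw [regret_eq henv halg]
  refine (integral_mono (integrable_finsetSum _ fun t _ => integrable_gap halg t)
    ((integrable_const _).add (integrable_finsetSum _ fun t _ => hint t))
    (sum_gap_le hmK halg hopt T hM hD0 hD)).trans ?_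
  rw [integral_add' (integrable_const _) (integrable_finsetSum _ fun t _ => hint t),
    integral_finsetSum _ fun t _ => hint t]
  simp only [integral_const, probReal_univ, one_smul]
  refine add_le_add le_rfl ?_
  calc _ ≤ ∑ t ∈ Finset.range T, 2 * m * (1 / ((t + 1 : ℕ) : ℝ) ^ 2) * gapMax K d kstar := by
        refine Finset.sum_le_sum fun t _ => ?_
        rw [integral_indicator_const _ (hmeas t), smul_eq_mul]
        exact mul_le_mul_of_nonneg_right (measureReal_not_isAccurate_le henv halg t)
          gapMax_nonneg
    _ = 2 * m * gapMax K d kstar * ∑ t ∈ Finset.range T, 1 / ((t + 1 : ℕ) : ℝ) ^ 2 := by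
        rw [Finset.mul_sum]
        exact Finset.sum_congr rfl fun t _ => by ring
    _ ≤ 2 * m * gapMax K d kstar * (Real.pi ^ 2 / 6) :=
        mul_le_mul_of_nonneg_left (sum_one_div_sq_le T)
          (mul_nonneg (by positivity) gapMax_nonneg)
    _ = _ := by ring

end Regret

end CommunityExploration

/-! ### Assembly in the extended reals. -/

theorem mainTheorem7 {m K : ℕ} (hmK : m < K) (d : Fin m → ℕ) (hd : ∀ i, 0 < d i)
    {Ω : Type*} {mΩ : MeasurableSpace Ω} (P : Measure Ω) [IsProbabilityMeasure P]
    (ℱ : Filtration ℕ mΩ) (Φ : ℕ → Ω → CommunityExploration.Realization K d)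
    (k : ℕ → Ω → Fin m → ℕ)
    (henv : CommunityExploration.IsOnlineEnvironment d P ℱ Φ)
    (halg : CommunityExploration.IsRevisedCLCB ℱ Φ k)
    (kstar : Fin m → ℕ) (hopt : CommunityExploration.IsOptimalAllocation K d kstar)
    (T : ℕ) (hT : 1 ≤ T) :
    ((CommunityExploration.regret P Φ kstar k T : ℝ) : EReal) ≤
      (∑ i : Fin m,
        ((48 * (((K - m + 1).choose 2 : ℕ) : ℝ) ^ 2 * Real.log T : ℝ) : EReal) /
          CommunityExploration.gapMin K d kstar i) +
      ((2 * (((K - m + 1).choose 2 : ℕ) : ℝ) * m +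
        Real.pi ^ 2 / 3 * m * CommunityExploration.gapMax K d kstar : ℝ) : EReal) := by
  have : ∀ i, NeZero (d i) := fun i => NeZero.of_pos (hd i)
  have hL : 0 ≤ Real.log T := Real.log_natCast_nonneg T
  have hex : ∀ i, ∃ M E : ℝ,
      (∀ a ∈ CommunityExploration.badActions K d kstar i,
        M ≤ CommunityExploration.gap K d kstar a) ∧ 0 ≤ E ∧
      ((CommunityExploration.badActions K d kstar i).Nonempty → ∀ N,
        ∑ s ∈ Finset.range N, CommunityExploration.charge (((K - m + 1).choose 2 : ℕ) : ℝ)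
          (Real.log T) M s ≤ E + 2 * (((K - m + 1).choose 2 : ℕ) : ℝ)) ∧
      ((48 * (((K - m + 1).choose 2 : ℕ) : ℝ) ^ 2 * Real.log T : ℝ) : EReal) /
          CommunityExploration.gapMin K d kstar i = (E : EReal) := by
    intro i
    rcases Set.eq_empty_or_nonempty (CommunityExploration.badActions K d kstar i) with h | h
    -- Without bad actions the quotient by `⊤` is `0`, and the conditions on `M` and the charges are
    -- vacuous.
    · refine ⟨0, 0, by simp [h], le_rfl, fun hne => absurd h hne.ne_empty, ?_⟩
      rw [CommunityExploration.gapMin_of_empty h, EReal.div_top, EReal.coe_zero]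
    · obtain ⟨M, hM0, hM, hle⟩ := CommunityExploration.exists_gapMin_eq_coe h
      refine ⟨M, 48 * (((K - m + 1).choose 2 : ℕ) : ℝ) ^ 2 * Real.log T / M, hle, by positivity,
        fun _ N => CommunityExploration.sum_charge_le (Nat.cast_nonneg _) hL hM0 N, ?_⟩
      rw [hM, EReal.coe_div]
  choose M E hM hE0 hE hdiv using hex
  have hmain := CommunityExploration.regret_le (kstar := kstar) hmK henv halg hopt T
    (M := M) (D := fun i => E i + 2 * (((K - m + 1).choose 2 : ℕ) : ℝ)) hM
    (fun i => add_nonneg (hE0 i) (by positivity)) hE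
  have hcoe : (∑ i, (E i : EReal)) = ((∑ i, E i : ℝ) : EReal) :=
    (map_sum (⟨⟨Real.toEReal, EReal.coe_zero⟩, EReal.coe_add⟩ : ℝ →+ EReal) E Finset.univ).symm
  rw [Finset.sum_congr rfl fun i _ => hdiv i, hcoe, ← EReal.coe_add, EReal.coe_le_coe_iff]
  refine hmain.trans (le_of_eq ?_)
  rw [Finset.sum_add_distrib, Finset.sum_const, Finset.card_univ, Fintype.card_fin, nsmul_eq_mul]
  ring
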